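/- Let $p$ be a prime number, let $k$ be a perfect field of characteristic $p$ and let $\bar k$ be an algebraic closure of $k$. An $\mathbb F_p$-scheme $Z$ is called perfect if its absolute Frobenius endomorphism (the identity on the underlying space and $a\mapsto a^p$ on sections) is an isomorphism. The inverse perfection of an $\mathbb F_p$-scheme $Y$ is the pair consisting of a perfect $\mathbb F_p$-scheme $Y^{\mathrm{pf}}$ and a morphism $\phi_Y\colon Y^{\mathrm{pf}}\to Y$ such that every morphism $Z\to Y$ from a perfect $\mathbb F_p$-scheme $Z$ factors uniquely through $\phi_Y$; it is obtained by glueing the affine schemes $\operatorname{Spec}(A^{\mathrm{pf}})$, where $\operatorname{Spec}A$ runs over the affine open subschemes of $Y$ and $A^{\mathrm{pf}}=\varinjlim(A\to A\to\cdots)$ with all transition maps equal to the Frobenius endomorphism $a\mapsto a^p$. If $Y$ is a $k$-scheme, $Y^{\mathrm{pf}}$ is a $k$-scheme via $Y^{\mathrm{pf}}\to Y\to\operatorname{Spec}k$. The functor $Y\mapsto Y^{\mathrm{pf}}$ on $k$-schemes commutes with finite products over $\operatorname{Spec}k$, so that $G^{\mathrm{pf}}$ is a $k$-group scheme for every $k$-group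 scheme $G$. Let $G$ be a $k$-group scheme locally of finite type such that $G(\bar k)=\operatorname{Hom}_k(\operatorname{Spec}\bar k,G)$ is the trivial group. Then $G^{\mathrm{pf}}$ is the trivial $k$-group scheme, i.e. $G^{\mathrm{pf}}$ is isomorphic, as a $k$-group scheme, to the trivial $k$-group scheme $\operatorname{Spec}k$. -/

import Mathlib

open CategoryTheory Limits AlgebraicGeometry Opposite
universe u
namespace AlgebraicGeometry.InversePerfection

/-- A scheme over `𝔽_p`, i.e. a scheme on which `p = 0`. (A morphism to `Spec 𝔽_p` is unique if it
exists, and it exists exactly in this case.) -/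
class IsFpScheme (p : ℕ) (X : Scheme.{u}) : Prop where
  natCast_eq_zero : (p : Γ(X, ⊤)) = 0

theorem IsFpScheme.cast_eq_zero (p : ℕ) (X : Scheme.{u}) [IsFpScheme p X] (U : X.Opens) :
    (p : Γ(X, U)) = 0 := by
  have h := congrArg (X.presheaf.map (homOfLE (le_top : U ≤ ⊤)).op).hom
    (IsFpScheme.natCast_eq_zero (p := p) (X := X))
  simpa only [map_natCast, map_zero] using h

theorem IsFpScheme.of_hom (p : ℕ) {X Y : Scheme.{u}} (f : X ⟶ Y) [IsFpScheme p Y] :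
    IsFpScheme p X := ⟨by
  have h := congrArg f.appTop.hom (IsFpScheme.natCast_eq_zero (p := p) (X := Y))
  simpa only [map_natCast, map_zero] using h⟩

instance (p : ℕ) {S : Scheme.{u}} [IsFpScheme p S] (X : Over S) : IsFpScheme p X.left :=
  .of_hom p X.hom

theorem IsFpScheme.spec (p : ℕ) (A : CommRingCat.{u}) (h : (p : A) = 0) :
    IsFpScheme p (Spec A) := ⟨by
  have h := congrArg (Scheme.ΓSpecIso A).inv.hom h
  simpa only [map_natCast, map_zero] using h⟩

instance (p : ℕ) (k : Type u) [Field k] [CharP k p] : IsFpScheme p (Spec (.of k)) :=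
  .spec p _ (CharP.cast_eq_zero k p)

theorem pow_injective (p : ℕ) {B : CommRingCat.{u}}
    (hb : Function.Injective (fun b : B => b ^ p)) (n : ℕ) :
    Function.Injective (fun b : B => b ^ p ^ n) := by
  induction n with
  | zero => intro a b; simp
  | succ n ih =>
    intro a b hab
    refine ih (hb ?_)
    simpa [← pow_mul, ← pow_succ] using hab

variable (p : ℕ) [Fact p.Prime]

/-- The Frobenius endomorphism `a ↦ a ^ p` of a ring in which `p = 0` (the zero ring included). -/
def frobRing (A : Type u) [CommRing A] (h : (p : A) = 0) : A →+* A where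
  toFun a := a ^ p
  map_one' := one_pow p
  map_mul' a b := mul_pow a b p
  map_zero' := zero_pow (Fact.out : p.Prime).ne_zero
  map_add' a b := by
    obtain ⟨r, hr⟩ := exists_add_pow_prime_eq (Fact.out : p.Prime) a b
    rw [hr, h]; ring

/-- The Frobenius endomorphism of the structure sheaf of an `𝔽_p`-scheme. -/
def frobPresheaf (X : Scheme.{u}) [IsFpScheme p X] :
    X.presheaf ⟶ X.presheaf where
  app U := CommRingCat.ofHom (frobRing p _ (IsFpScheme.cast_eq_zero p X U.unop))
  naturality _ _ i := by
    ext a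
    exact map_pow (X.presheaf.map i).hom a p |>.symm

/-- The absolute Frobenius endomorphism of an `𝔽_p`-scheme: the identity on the underlying space and
`a ↦ a ^ p` on sections. -/
def frob (X : Scheme.{u}) [IsFpScheme p X] : X ⟶ X :=
  Scheme.Hom.mk
    { base := 𝟙 _
      c := frobPresheaf p X
      prop := fun x => ⟨fun a ha => by
        obtain ⟨U, hxU, s, rfl⟩ := X.presheaf.exists_germ_eq a
        have h := ConcreteCategory.congr_hom (PresheafedSpace.stalkMap_germ (C := CommRingCat)
          (X := X.toPresheafedSpace) (Y := X.toPresheafedSpace)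
          (PresheafedSpace.Hom.mk (𝟙 _) (frobPresheaf p X)) U x hxU) s
        have h2 : IsUnit ((X.presheaf.germ U x hxU).hom (s ^ p)) := by
          have := ha
          erw [h] at this
          exact this
        rw [map_pow] at h2
        exact (isUnit_pow_iff (Fact.out : p.Prime).ne_zero).mp h2⟩ }

theorem frob_app (X : Scheme.{u}) [IsFpScheme p X] (U : X.Opens)
    (a : Γ(X, U)) : (frob p X).app U a = a ^ p := rfl

theorem frob_naturality {X Y : Scheme.{u}} [IsFpScheme p X]
    [IsFpScheme p Y] (f : X ⟶ Y) : frob p X ≫ f = f ≫ frob p Y := by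
  refine Scheme.Hom.ext rfl fun U => ?_
  ext a
  have h1 : (X.presheaf.map (𝟙 (op (f ⁻¹ᵁ U)))) (((f.app U) a) ^ p) = f.app U (a ^ p) := by
    rw [CategoryTheory.Functor.map_id]
    exact (map_pow (f.app U).hom a p).symm
  exact h1

/-- An `𝔽_p`-scheme is perfect if its absolute Frobenius endomorphism is an isomorphism. -/
class IsPerfect (X : Scheme.{u}) [IsFpScheme p X] : Prop where
  isIso_frob : IsIso (frob p X)

attribute [instance] IsPerfect.isIso_frob

theorem frob_bijective (X : Scheme.{u}) [IsFpScheme p X] [IsPerfect p X] (U : X.Opens) :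
    Function.Bijective (fun a : Γ(X, U) => a ^ p) :=
  ConcreteCategory.bijective_of_isIso ((frob p X).app U)

theorem IsPerfect.of_isOpenImmersion {V X : Scheme.{u}} (j : V ⟶ X) [IsOpenImmersion j]
    [IsFpScheme p V] [IsFpScheme p X] [IsPerfect p X] : IsPerfect p V := ⟨by
  have h : IsPullback (frob p V) j j (frob p X) :=
    IsOpenImmersion.isPullback _ _ _ _ (frob_naturality p j).symm rfl
  exact MorphismProperty.of_isPullback (P := .isomorphisms _) h.flip
    (inferInstanceAs (IsIso (frob p X)))⟩

theorem IsPerfect.of_openCover {X : Scheme.{u}} [IsFpScheme p X] (𝒰 : X.OpenCover)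
    [∀ i, IsFpScheme p (𝒰.X i)] [∀ i, IsPerfect p (𝒰.X i)] : IsPerfect p X := ⟨by
  refine (IsZariskiLocalAtTarget.iff_of_openCover (P := .isomorphisms _) 𝒰).mpr fun i => ?_
  have h : IsPullback (frob p (𝒰.X i)) (𝒰.f i) (𝒰.f i) (frob p X) :=
    IsOpenImmersion.isPullback _ _ _ _ (frob_naturality p _).symm rfl
  have e : h.flip.isoPullback.hom ≫ pullback.snd _ _ = frob p (𝒰.X i) :=
    h.flip.isoPullback_hom_snd
  change IsIso (pullback.snd _ _)
  rw [← Iso.eq_inv_comp] at e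
  rw [e]
  infer_instance⟩

theorem IsPerfect.spec (A : CommRingCat.{u}) [IsFpScheme p (Spec A)]
    (h : Function.Bijective (fun a : A => a ^ p)) (h0 : (p : A) = 0) : IsPerfect p (Spec A) := ⟨by
  have h1 : frob p (Spec A) = Spec.map (CommRingCat.ofHom (frobRing p A h0)) := by
    refine ext_to_Spec (R := A) ?_
    ext a
    have h2 := ConcreteCategory.congr_hom
      (Scheme.ΓSpecIso_inv_naturality (CommRingCat.ofHom (frobRing p A h0))) a
    refine Eq.trans ?_ h2
    exact (map_pow (Scheme.ΓSpecIso A).inv.hom a p).symm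
  have : IsIso (CommRingCat.ofHom (frobRing p A h0)) :=
    (ConcreteCategory.isIso_iff_bijective _).mpr h
  rw [h1]
  infer_instance⟩

theorem IsPerfect.pullback {X Y S : Scheme.{u}} (f : X ⟶ S) (g : Y ⟶ S) [IsFpScheme p X]
    [IsFpScheme p Y] [IsFpScheme p S] [IsPerfect p X] [IsPerfect p Y] [IsPerfect p S]
    [IsFpScheme p (pullback f g)] :
    IsPerfect p (pullback f g) := ⟨by
  have : frob p (Limits.pullback f g) = pullback.map f g f g (frob p X) (frob p Y) (frob p S)
      (frob_naturality p f).symm (frob_naturality p g).symm := by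
    apply pullback.hom_ext
    · exact (frob_naturality p _).trans (pullback.lift_fst _ _ _).symm
    · exact (frob_naturality p _).trans (pullback.lift_snd _ _ _).symm
  rw [this]
  infer_instance⟩

instance IsPerfect.spec_field (k : Type u) [Field k] [CharP k p] [PerfectField k] :
    IsPerfect p (Spec (.of k)) := by
  have : ExpChar k p := .prime Fact.out
  exact .spec p _ (bijective_frobenius k p) (CharP.cast_eq_zero k p)

noncomputable section

section Ring

variable {A : CommRingCat.{u}} (h : (p : A) = 0)

/-- The sequence `A ⟶ A ⟶ A ⟶ ⋯` whose transition maps are all the Frobenius endomorphism. -/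
def frobTower : ℕ ⥤ CommRingCat.{u} :=
  Functor.ofSequence (X := fun _ => A) (fun _ => CommRingCat.ofHom (frobRing p A h))

theorem frobTower_map_succ (n : ℕ) : (frobTower p h).map (homOfLE (Nat.le_add_right n 1)) =
    CommRingCat.ofHom (frobRing p A h) :=
  Functor.ofSequence_map_homOfLE_succ _ n

/-- The perfect closure `A^pf` of an `𝔽_p`-algebra `A`: the colimit of `A ⟶ A ⟶ A ⟶ ⋯` along
Frobenius. -/
def perfClosure : CommRingCat.{u} := colimit (frobTower p h)

/-- The map from the `n`-th copy of `A` to `A^pf`; it sends `a` to the `p ^ n`-th root of `a`. -/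
def perfClosureι (n : ℕ) : A ⟶ perfClosure p h := colimit.ι (frobTower p h) n

/-- The canonical map `A ⟶ A^pf`. -/
abbrev toPerfClosure : A ⟶ perfClosure p h := perfClosureι p h 0

theorem perfClosureι_succ (n : ℕ) (a : A) : perfClosureι p h (n + 1) (a ^ p) = perfClosureι p h n a := by
  have hw := colimit.w (frobTower p h) (homOfLE (Nat.le_add_right n 1))
  rw [frobTower_map_succ] at hw
  exact ConcreteCategory.congr_hom hw a

theorem perfClosureι_add (n m : ℕ) (a : A) : perfClosureι p h (n + m) (a ^ p ^ m) = perfClosureι p h n a := by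
  induction m with
  | zero => simp
  | succ m ih => rw [← ih, ← perfClosureι_succ p h (n + m), ← pow_mul, ← pow_succ]; rfl

theorem frobTower_map (i m : ℕ) (f : i ⟶ i + m) (a : A) :
    (frobTower p h).map f a = a ^ p ^ m := by
  induction m with
  | zero =>
    obtain rfl : f = 𝟙 _ := Subsingleton.elim _ _
    rw [CategoryTheory.Functor.map_id, pow_zero, pow_one]
    rfl
  | succ m ih =>
    obtain rfl : f = homOfLE (Nat.le_add_right i m) ≫ homOfLE (Nat.le_add_right (i + m) 1) :=
      Subsingleton.elim _ _
    rw [CategoryTheory.Functor.map_comp, frobTower_map_succ]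
    refine (congrArg (fun x : A => x ^ p) (ih (homOfLE (Nat.le_add_right i m)))).trans ?_
    rw [← pow_mul, ← pow_succ]

instance : PreservesColimitsOfShape ℕ (forget CommRingCat.{u}) :=
  have := preservesSmallestFilteredColimits_of_preservesFilteredColimits.{u, u} (forget CommRingCat.{u})
  inferInstance

theorem perfClosureι_exists (z : perfClosure p h) : ∃ n a, perfClosureι p h n a = z :=
  Concrete.colimit_exists_rep (frobTower p h) z

theorem perfClosureι_eq_zero {n : ℕ} {a : A} (ha : perfClosureι p h n a = 0) : ∃ m, a ^ p ^ m = 0 := by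
  have h0 : perfClosureι p h n a = perfClosureι p h n 0 := by rw [ha, map_zero]
  obtain ⟨k, f, g, hk⟩ := Concrete.colimit_exists_of_rep_eq (frobTower p h) (i := n) (j := n)
    a 0 h0
  obtain ⟨m, rfl⟩ := Nat.exists_eq_add_of_le (leOfHom f)
  exact ⟨m, (frobTower_map p h n m f a).symm.trans (hk.trans (map_zero _))⟩

theorem perfClosureι_pow (n : ℕ) (a : A) : (perfClosureι p h n a) ^ p ^ n = perfClosureι p h 0 a := by
  rw [← map_pow, ← perfClosureι_add p h 0 n a, zero_add]

theorem perfClosure_natCast : (p : perfClosure p h) = 0 := by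
  have h1 := congrArg (perfClosureι p h 0) h
  simpa only [map_natCast, map_zero] using h1

/-- `A^pf` is perfect. -/
theorem perfClosure_bijective : Function.Bijective (fun z : perfClosure p h => z ^ p) := by
  constructor
  · refine (injective_iff_map_eq_zero (frobRing p _ (perfClosure_natCast p h))).mpr fun z hz => ?_
    obtain ⟨n, a, rfl⟩ := perfClosureι_exists p h z
    have h1 : perfClosureι p h n (a ^ p) = 0 := (map_pow _ _ _).trans hz
    obtain ⟨m, hm⟩ := perfClosureι_eq_zero p h h1
    rw [← perfClosureι_add p h n (m + 1), pow_succ', pow_mul, hm, map_zero]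
  · intro z
    obtain ⟨n, a, rfl⟩ := perfClosureι_exists p h z
    exact ⟨perfClosureι p h (n + 1) a, (map_pow _ _ _).symm.trans (perfClosureι_succ p h n a)⟩

variable {B : CommRingCat.{u}}

theorem perfClosure_hom_ext (hb : Function.Injective (fun b : B => b ^ p))
    {χ χ' : perfClosure p h ⟶ B} (e : toPerfClosure p h ≫ χ = toPerfClosure p h ≫ χ') : χ = χ' := by
  ext z
  obtain ⟨n, a, rfl⟩ := perfClosureι_exists p h z
  apply pow_injective p hb n
  change (χ (perfClosureι p h n a)) ^ p ^ n = (χ' (perfClosureι p h n a)) ^ p ^ n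
  rw [← map_pow χ.hom, ← map_pow χ'.hom, perfClosureι_pow]
  exact ConcreteCategory.congr_hom e a

theorem exists_perfClosureLift (hB : (p : B) = 0)
    (hb : Function.Bijective (fun b : B => b ^ p)) (ψ : A ⟶ B) :
    ∃ χ : perfClosure p h ⟶ B, toPerfClosure p h ≫ χ = ψ := by
  let e := RingEquiv.ofBijective (frobRing p B hB) hb
  let r : B →+* B := (e.symm : B →+* B)
  have hr : ∀ b, r (b ^ p) = b := fun b => e.symm_apply_apply b
  have hr' : ∀ m b, (r ^ m : B →+* B) (b ^ p ^ m) = b := by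
    intro m
    induction m with
    | zero => intro b; simp
    | succ m ih =>
      intro b
      rw [pow_succ, pow_succ, pow_mul]
      change (r ^ m) (r _) = _
      rw [hr, ih]
  let c : Cocone (frobTower p h) :=
    { pt := B
      ι :=
        { app := fun n => (CommRingCat.ofHom ((r ^ n : B →+* B).comp ψ.hom) : A ⟶ B)
          naturality := by
            intro i j f
            ext a
            obtain ⟨m, rfl⟩ := Nat.exists_eq_add_of_le (leOfHom f)
            refine (congrArg (fun x : A => (r ^ (i + m) : B →+* B) (ψ.hom x))
              (frobTower_map p h i m f a)).trans ?_
            refine (congrArg (r ^ (i + m) : B →+* B) (map_pow ψ.hom (a : A) (p ^ m))).trans ?_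
            rw [pow_add]
            exact congrArg (r ^ i : B →+* B) (hr' m _) } }
  refine ⟨colimit.desc _ c, ?_⟩
  exact (colimit.ι_desc c 0).trans (by ext a; rfl)

/-- The universal property of the perfect closure: maps from `A` to perfect rings factor through
`A^pf`, uniquely by `perfClosure_hom_ext`. -/
def perfClosureLift (hB : (p : B) = 0)
    (hb : Function.Bijective (fun b : B => b ^ p)) (ψ : A ⟶ B) : perfClosure p h ⟶ B :=
  (exists_perfClosureLift p h hB hb ψ).choose

@[simp]
theorem toPerfClosure_perfClosureLift (hB : (p : B) = 0)
    (hb : Function.Bijective (fun b : B => b ^ p)) (ψ : A ⟶ B) :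
    toPerfClosure p h ≫ perfClosureLift p h hB hb ψ = ψ :=
  (exists_perfClosureLift p h hB hb ψ).choose_spec

/-- Functoriality of the perfect closure. -/
def perfClosureMap (hB : (p : B) = 0) (f : A ⟶ B) : perfClosure p h ⟶ perfClosure p hB :=
  perfClosureLift p h (perfClosure_natCast p hB) (perfClosure_bijective p hB) (f ≫ toPerfClosure p hB)

theorem toPerfClosure_perfClosureMap (hB : (p : B) = 0) (f : A ⟶ B) :
    toPerfClosure p h ≫ perfClosureMap p h hB f = f ≫ toPerfClosure p hB :=
  toPerfClosure_perfClosureLift p h _ _ _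

theorem perfClosureMap_perfClosureι (hB : (p : B) = 0) (f : A ⟶ B) (n : ℕ) (a : A) :
    perfClosureMap p h hB f (perfClosureι p h n a) = perfClosureι p hB n (f a) := by
  apply pow_injective p (perfClosure_bijective p hB).1 n
  change _ ^ p ^ n = _ ^ p ^ n
  rw [← map_pow (perfClosureMap p h hB f).hom, perfClosureι_pow, perfClosureι_pow]
  exact ConcreteCategory.congr_hom (toPerfClosure_perfClosureMap p h hB f) a

/-- The perfect closure commutes with inverting one element. -/
theorem isLocalization_perfClosure (hB : (p : B) = 0) (f : A ⟶ B) (s : A)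
    (hs : letI := f.hom.toAlgebra; IsLocalization.Away s B) :
    letI := (perfClosureMap p h hB f).hom.toAlgebra
    IsLocalization.Away (toPerfClosure p h s) (perfClosure p hB) := by
  let := f.hom.toAlgebra
  let := (perfClosureMap p h hB f).hom.toAlgebra
  have hp : 1 ≤ p := (Fact.out : p.Prime).one_le
  have hm (a : A) : perfClosureMap p h hB f (toPerfClosure p h a) = toPerfClosure p hB (f a) :=
    perfClosureMap_perfClosureι p h hB f 0 a
  have hunit : IsUnit (f s) := IsLocalization.Away.algebraMap_isUnit (S := B) s
  refine IsLocalization.Away.mk _ ?_ ?_ ?_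
  · change IsUnit (perfClosureMap p h hB f (toPerfClosure p h s))
    rw [hm]
    exact hunit.map (toPerfClosure p hB).hom
  · intro z
    obtain ⟨n, b, rfl⟩ := perfClosureι_exists p hB z
    obtain ⟨m, a, ha⟩ := IsLocalization.Away.surj (S := B) s b
    change b * f s ^ m = f a at ha
    refine ⟨m, perfClosureι p h n (a * s ^ (m * (p ^ n - 1))), ?_⟩
    change perfClosureι p hB n b * (perfClosureMap p h hB f (perfClosureι p h 0 s)) ^ m = perfClosureMap p h hB f (perfClosureι p h n _)
    rw [perfClosureMap_perfClosureι, perfClosureMap_perfClosureι, ← perfClosureι_add p hB 0 n (f s), zero_add]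
    change (perfClosureι p hB n).hom b * ((perfClosureι p hB n).hom (f.hom s ^ p ^ n)) ^ m =
      (perfClosureι p hB n).hom (f.hom (a * s ^ (m * (p ^ n - 1))))
    rw [← map_pow, ← map_mul, map_mul f.hom, RingHom.map_pow f.hom]
    congr 1
    change b * f.hom s ^ m = f.hom a at ha
    obtain ⟨q, hq⟩ := Nat.exists_eq_add_of_le' (Nat.one_le_pow n p hp)
    rw [← ha, mul_assoc, ← pow_mul, ← pow_add, hq, Nat.add_sub_cancel]
    congr 2
    ring
  · intro x y hxy
    have hz : perfClosureMap p h hB f (x - y) = 0 := by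
      rw [map_sub]; exact sub_eq_zero.mpr hxy
    obtain ⟨n, d, hd⟩ := perfClosureι_exists p h (x - y)
    rw [← hd, perfClosureMap_perfClosureι] at hz
    obtain ⟨m, hm'⟩ := perfClosureι_eq_zero p hB hz
    have hd' : algebraMap A B (d ^ p ^ m) = algebraMap A B 0 := by
      rw [map_zero]; exact (map_pow f.hom d _).trans hm'
    obtain ⟨N, hN⟩ := IsLocalization.Away.exists_of_eq (S := B) s hd'
    refine ⟨N, ?_⟩
    rw [← sub_eq_zero, ← mul_sub, ← hd]
    rw [mul_zero] at hN
    apply pow_injective p (perfClosure_bijective p h).1 m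
    change (perfClosureι p h 0 s ^ N * perfClosureι p h n d) ^ p ^ m = 0 ^ p ^ m
    rw [zero_pow (pow_ne_zero _ (by omega)), ← perfClosureι_add p h 0 n s, zero_add, ← map_pow, ← map_mul,
      ← map_pow]
    have : ((s ^ p ^ n) ^ N * d) ^ p ^ m = 0 := by
      obtain ⟨q, hq⟩ := Nat.exists_eq_add_of_le' (Nat.one_le_pow (n + m) p hp)
      have e : ((s ^ p ^ n) ^ N * d) ^ p ^ m = s ^ (q * N) * (s ^ N * d ^ p ^ m) := by
        rw [mul_pow, ← mul_assoc, ← pow_add, ← pow_mul, ← pow_mul]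
        congr 2
        rw [mul_left_comm, ← pow_add, hq]
        ring
      rw [e, hN, mul_zero]
    rw [this, map_zero]

end Ring

section Scheme

variable (Y : Scheme.{u}) [IsFpScheme p Y]

/-- The presheaf of rings `U ↦ Γ(Y, U)^pf`. -/
def perfectionPresheaf : Y.Opensᵒᵖ ⥤ CommRingCat.{u} where
  obj U := perfClosure p (IsFpScheme.cast_eq_zero p Y U.unop)
  map i := perfClosureMap p _ _ (Y.presheaf.map i)
  map_id _ := by
    apply perfClosure_hom_ext p _ (perfClosure_bijective p _).1
    rw [toPerfClosure_perfClosureMap, CategoryTheory.Functor.map_id, Category.id_comp, Category.comp_id]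
  map_comp i j := by
    apply perfClosure_hom_ext p _ (perfClosure_bijective p _).1
    rw [toPerfClosure_perfClosureMap, ← Category.assoc, toPerfClosure_perfClosureMap, Category.assoc,
      toPerfClosure_perfClosureMap, CategoryTheory.Functor.map_comp, Category.assoc]

/-- The canonical map from the structure sheaf to `U ↦ Γ(Y, U)^pf`. -/
def toPerfectionPresheaf : Y.presheaf ⟶ perfectionPresheaf p Y where
  app _ := toPerfClosure p _
  naturality _ _ i := (toPerfClosure_perfClosureMap p _ _ (Y.presheaf.map i)).symm

open Scheme.AffineZariskiSite

theorem coequifibered_toPerfectionPresheaf :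
    ((toOpensFunctor Y).op.whiskerLeft (toPerfectionPresheaf p Y)).Coequifibered :=
  coequifibered_iff_forall_isLocalizationAway.mpr fun U r =>
    isLocalization_perfClosure p _ _ (Y.presheaf.map (homOfLE (Y.basicOpen_le r)).op) r
      (U.2.isLocalization_basicOpen r)

/-- The affine schemes `Spec (Γ(Y, U)^pf)`, for `U` running over the affine opens of `Y`, with their
gluing data. -/
def perfectionGluingData := relativeGluingData (coequifibered_toPerfectionPresheaf p Y)

/-- The inverse perfection `Y^pf` of an `𝔽_p`-scheme `Y`, glued from the schemes `Spec (Γ(Y, U)^pf)`. -/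
def perfection : Scheme.{u} := (perfectionGluingData p Y).glued

/-- The canonical morphism `Y^pf ⟶ Y`. -/
def perfectionπ : perfection p Y ⟶ Y := (perfectionGluingData p Y).toBase

instance : IsFpScheme p (perfection p Y) := .of_hom p (perfectionπ p Y)

/-- The open cover of `Y^pf` by the schemes `Spec (Γ(Y, U)^pf)`. -/
def perfectionCover : (perfection p Y).OpenCover := (perfectionGluingData p Y).cover

/-- The inclusion of `Spec (Γ(Y, U)^pf)` into `Y^pf`. -/
def perfectionChart (U : Y.AffineZariskiSite) :
    Spec (perfClosure p (IsFpScheme.cast_eq_zero p Y U.1)) ⟶ perfection p Y :=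
  (perfectionCover p Y).f U

theorem isPullback_perfectionChart (U : Y.AffineZariskiSite) :
    IsPullback (Spec.map (toPerfClosure p (IsFpScheme.cast_eq_zero p Y U.1)) ≫ U.2.isoSpec.inv)
      (perfectionChart p Y U) U.1.ι (perfectionπ p Y) :=
  (perfectionGluingData p Y).isPullback_natTrans_ι_toBase U

instance : IsPerfect p (perfection p Y) := by
  have h1 (i) : IsFpScheme p ((perfectionCover p Y).X i) := .of_hom p ((perfectionCover p Y).f i)
  have h2 (i) : IsPerfect p ((perfectionCover p Y).X i) := by
    have : IsFpScheme p (Spec (perfClosure p (IsFpScheme.cast_eq_zero p Y i.1))) := h1 i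
    exact IsPerfect.spec p (perfClosure p (IsFpScheme.cast_eq_zero p Y i.1)) (perfClosure_bijective p _)
      (perfClosure_natCast p _)
  exact .of_openCover p (perfectionCover p Y)

variable {Y} {Z : Scheme.{u}} [IsFpScheme p Z] [IsPerfect p Z]

theorem spec_perfClosure_hom_ext {A : CommRingCat.{u}} (hA : (p : A) = 0) {g h : Z ⟶ Spec (perfClosure p hA)}
    (e : g ≫ Spec.map (toPerfClosure p hA) = h ≫ Spec.map (toPerfClosure p hA)) : g = h := by
  refine ext_to_Spec (R := perfClosure p hA) ?_
  apply perfClosure_hom_ext p hA (frob_bijective p Z ⊤).1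
  have h1 := congrArg (fun t => (Scheme.ΓSpecIso A).inv ≫ t.appTop) e
  simp only [Scheme.Hom.comp_appTop, ← Scheme.ΓSpecIso_inv_naturality_assoc] at h1
  exact h1

theorem exists_spec_perfClosure_lift {A : CommRingCat.{u}} (hA : (p : A) = 0) (g : Z ⟶ Spec A) :
    ∃ h : Z ⟶ Spec (perfClosure p hA), h ≫ Spec.map (toPerfClosure p hA) = g := by
  refine ⟨Z.toSpecΓ ≫ Spec.map (perfClosureLift p hA (IsFpScheme.cast_eq_zero p Z ⊤)
    (frob_bijective p Z ⊤) ((Scheme.ΓSpecIso A).inv ≫ g.appTop)), ?_⟩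
  rw [Category.assoc, ← Spec.map_comp, toPerfClosure_perfClosureLift, Spec.map_comp,
    ← Scheme.toSpecΓ_naturality_assoc]
  simp

theorem perfection_hom_ext {g h : Z ⟶ perfection p Y} (e : g ≫ perfectionπ p Y = h ≫ perfectionπ p Y) : g = h := by
  let 𝒱 : Z.OpenCover := Precoverage.ZeroHypercover.pullback₁ (g ≫ perfectionπ p Y) (directedCover Y)
  refine Scheme.Cover.hom_ext 𝒱 _ _ fun (U : Y.AffineZariskiSite) => ?_
  let j : pullback (g ≫ perfectionπ p Y) U.1.ι ⟶ Z := pullback.fst _ _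
  let s : pullback (g ≫ perfectionπ p Y) U.1.ι ⟶ U.1 := pullback.snd _ _
  change j ≫ g = j ≫ h
  have : IsFpScheme p (pullback (g ≫ perfectionπ p Y) U.1.ι) := .of_hom p j
  have : IsPerfect p (pullback (g ≫ perfectionπ p Y) U.1.ι) := .of_isOpenImmersion p j
  have hP := isPullback_perfectionChart p Y U
  have hg : s ≫ U.1.ι = (j ≫ g) ≫ perfectionπ p Y :=
    pullback.condition.symm.trans (Category.assoc _ _ _).symm
  have hh : s ≫ U.1.ι = (j ≫ h) ≫ perfectionπ p Y :=
    hg.trans ((Category.assoc _ _ _).trans ((congrArg (j ≫ ·) e).trans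
      (Category.assoc _ _ _).symm))
  rw [← hP.lift_snd _ _ hg, ← hP.lift_snd _ _ hh]
  congr 1
  have e1 := (hP.lift_fst _ _ hg).trans (hP.lift_fst _ _ hh).symm
  rw [← Category.assoc, ← Category.assoc, cancel_mono] at e1
  exact spec_perfClosure_hom_ext p _ e1

theorem exists_perfection_lift (ψ : Z ⟶ Y) : ∃ χ : Z ⟶ perfection p Y, χ ≫ perfectionπ p Y = ψ := by
  let 𝒱 : Z.OpenCover := Precoverage.ZeroHypercover.pullback₁ ψ (directedCover Y)
  have hloc (U : 𝒱.I₀) : ∃ χ : 𝒱.X U ⟶ perfection p Y, χ ≫ perfectionπ p Y = 𝒱.f U ≫ ψ := by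
    let U' : Y.AffineZariskiSite := U
    change ∃ χ : pullback ψ U'.1.ι ⟶ perfection p Y, χ ≫ perfectionπ p Y = pullback.fst ψ U'.1.ι ≫ ψ
    have : IsFpScheme p (pullback ψ U'.1.ι) := .of_hom p (pullback.fst _ _)
    have : IsPerfect p (pullback ψ U'.1.ι) := .of_isOpenImmersion p (pullback.fst _ _)
    obtain ⟨t, ht⟩ := exists_spec_perfClosure_lift p (IsFpScheme.cast_eq_zero p Y U'.1)
      (pullback.snd ψ U'.1.ι ≫ U'.2.isoSpec.hom)
    refine ⟨t ≫ perfectionChart p Y U', ?_⟩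
    rw [Category.assoc, ← (isPullback_perfectionChart p Y U').w, ← Category.assoc, ← Category.assoc, ht]
    simp only [Category.assoc, Iso.hom_inv_id, Category.comp_id]
    exact pullback.condition.symm
  choose χ hχ using hloc
  refine ⟨𝒱.glueMorphisms χ fun U V => ?_, ?_⟩
  · have : IsFpScheme p (pullback (𝒱.f U) (𝒱.f V)) := .of_hom p (pullback.fst _ _ ≫ 𝒱.f U)
    have : IsPerfect p (pullback (𝒱.f U) (𝒱.f V)) :=
      .of_isOpenImmersion p (pullback.fst _ _ ≫ 𝒱.f U)
    apply perfection_hom_ext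
    rw [Category.assoc, Category.assoc, hχ, hχ, pullback.condition_assoc]
  · refine Scheme.Cover.hom_ext 𝒱 _ _ fun U => ?_
    rw [Scheme.Cover.ι_glueMorphisms_assoc, hχ]

/-- The universal property of the inverse perfection: `Y^pf ⟶ Y` is universal among morphisms from
perfect `𝔽_p`-schemes to `Y`. -/
theorem existsUnique_perfection_lift (ψ : Z ⟶ Y) : ∃! χ : Z ⟶ perfection p Y, χ ≫ perfectionπ p Y = ψ := by
  obtain ⟨χ, hχ⟩ := exists_perfection_lift p ψ
  exact ⟨χ, hχ, fun χ' h' => perfection_hom_ext p (h'.trans hχ.symm)⟩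

end Scheme

section Over


/-- The factorization of a morphism from a perfect scheme to `Y` through `Y^pf`. -/
def perfectionLift {Z Y : Scheme.{u}} [IsFpScheme p Z] [IsPerfect p Z] [IsFpScheme p Y]
    (ψ : Z ⟶ Y) : Z ⟶ perfection p Y :=
  (existsUnique_perfection_lift p ψ).choose

@[simp]
theorem perfectionLift_perfectionπ {Z Y : Scheme.{u}} [IsFpScheme p Z] [IsPerfect p Z] [IsFpScheme p Y]
    (ψ : Z ⟶ Y) : perfectionLift p ψ ≫ perfectionπ p Y = ψ :=
  (existsUnique_perfection_lift p ψ).choose_spec.1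

@[simp]
theorem perfectionLift_perfectionπ_assoc {Z Y W : Scheme.{u}} [IsFpScheme p Z] [IsPerfect p Z]
    [IsFpScheme p Y] (ψ : Z ⟶ Y) (f : Y ⟶ W) : perfectionLift p ψ ≫ perfectionπ p Y ≫ f = ψ ≫ f := by
  rw [← Category.assoc, perfectionLift_perfectionπ]

/-- Functoriality of the inverse perfection. -/
def perfectionMap {X Y : Scheme.{u}} [IsFpScheme p X] [IsFpScheme p Y] (f : X ⟶ Y) : perfection p X ⟶ perfection p Y :=
  perfectionLift p (perfectionπ p X ≫ f)

@[simp]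
theorem perfectionMap_π {X Y : Scheme.{u}} [IsFpScheme p X] [IsFpScheme p Y] (f : X ⟶ Y) :
    perfectionMap p f ≫ perfectionπ p Y = perfectionπ p X ≫ f := perfectionLift_perfectionπ p _

@[simp]
theorem perfectionMap_π_assoc {X Y W : Scheme.{u}} [IsFpScheme p X] [IsFpScheme p Y] (f : X ⟶ Y)
    (g : Y ⟶ W) : perfectionMap p f ≫ perfectionπ p Y ≫ g = perfectionπ p X ≫ f ≫ g := by
  rw [← Category.assoc, perfectionMap_π, Category.assoc]

/-- The inverse perfection as a functor on the category of `S`-schemes: `Y^pf` is an `S`-scheme through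
`Y^pf ⟶ Y ⟶ S`. -/
def perfectionOver (S : Scheme.{u}) [IsFpScheme p S] : Over S ⥤ Over S where
  obj X := Over.mk (perfectionπ p X.left ≫ X.hom)
  map {X Y} f := Over.homMk (perfectionMap p f.left) (by simp)
  map_id X := by
    ext1
    exact perfection_hom_ext p (Z := perfection p X.left) (by simp)
  map_comp {X Y Z} f g := by
    ext1
    exact perfection_hom_ext p (Z := perfection p X.left) (by simp)

variable {S : Scheme.{u}} [IsFpScheme p S]

instance (X : Over S) : IsPerfect p ((perfectionOver p S).obj X).left :=
  inferInstanceAs (IsPerfect p (perfection p X.left))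

/-- The canonical morphism of `S`-schemes `Y^pf ⟶ Y`. -/
def perfectionOverπ (X : Over S) : (perfectionOver p S).obj X ⟶ X :=
  Over.homMk (U := Over.mk (perfectionπ p X.left ≫ X.hom)) (perfectionπ p X.left)

/-- The factorization of a morphism of `S`-schemes from a perfect scheme to `Y` through `Y^pf`. -/
def perfectionOverLift {Z X : Over S} [IsPerfect p Z.left] (ψ : Z ⟶ X) : Z ⟶ (perfectionOver p S).obj X :=
  Over.homMk (V := Over.mk (perfectionπ p X.left ≫ X.hom)) (perfectionLift p ψ.left) (by simp)

@[simp]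
theorem perfectionOverLift_π {Z X : Over S} [IsPerfect p Z.left] (ψ : Z ⟶ X) :
    perfectionOverLift p ψ ≫ perfectionOverπ p X = ψ := by
  ext1
  exact perfectionLift_perfectionπ p ψ.left

theorem perfectionOver_hom_ext {Z X : Over S} [IsPerfect p Z.left] {g h : Z ⟶ (perfectionOver p S).obj X}
    (e : g ≫ perfectionOverπ p X = h ≫ perfectionOverπ p X) : g = h := by
  ext1
  exact perfection_hom_ext p (congrArg CommaMorphism.left e)

theorem perfectionOver_map_π {X Y : Over S} (f : X ⟶ Y) :
    (perfectionOver p S).map f ≫ perfectionOverπ p Y = perfectionOverπ p X ≫ f := by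
  ext1
  exact perfectionMap_π p f.left

open MonoidalCategory CartesianMonoidalCategory

section
variable [IsPerfect p S]

instance : IsPerfect p (𝟙_ (Over S)).left := ‹IsPerfect p S›

instance (X Y : Over S) [IsPerfect p X.left] [IsPerfect p Y.left] : IsPerfect p (X ⊗ Y).left :=
  have : IsFpScheme p (pullback X.hom Y.hom) := inferInstanceAs (IsFpScheme p (X ⊗ Y).left)
  IsPerfect.pullback p X.hom Y.hom

instance : IsIso (CartesianMonoidalCategory.terminalComparison (perfectionOver p S)) :=
  ⟨perfectionOverLift p (𝟙 _), perfectionOver_hom_ext p (toUnit_unique _ _),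
    toUnit_unique _ _⟩

instance (X Y : Over S) : IsIso (CartesianMonoidalCategory.prodComparison (perfectionOver p S) X Y) := by
  let c : (perfectionOver p S).obj X ⊗ (perfectionOver p S).obj Y ⟶ X ⊗ Y := perfectionOverπ p X ⊗ₘ perfectionOverπ p Y
  let l : (perfectionOver p S).obj X ⊗ (perfectionOver p S).obj Y ⟶ (perfectionOver p S).obj (X ⊗ Y) := perfectionOverLift p c
  have hl : l ≫ perfectionOverπ p (X ⊗ Y) = c := perfectionOverLift_π p c
  have hl' {W : Over S} (f : X ⊗ Y ⟶ W) : l ≫ perfectionOverπ p (X ⊗ Y) ≫ f = c ≫ f := by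
    rw [← hl, Category.assoc]
  have hc : CartesianMonoidalCategory.prodComparison (perfectionOver p S) X Y ≫ c =
      perfectionOverπ p (X ⊗ Y) := by
    ext1
    · simp [c, ← perfectionOver_map_π]
    · simp [c, ← perfectionOver_map_π]
  refine ⟨l, perfectionOver_hom_ext p ?_, ?_⟩
  · rw [Category.assoc, hl, hc, Category.id_comp]
  · ext1
    · refine perfectionOver_hom_ext p ?_
      rw [Category.assoc, Category.assoc, Category.assoc]
      simp [perfectionOver_map_π, hl', c]
    · refine perfectionOver_hom_ext p ?_
      rw [Category.assoc, Category.assoc, Category.assoc]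
      simp [perfectionOver_map_π, hl', c]

/-- Over a perfect base `S`, the inverse perfection commutes with finite products over `S`. -/
instance : (perfectionOver p S).Monoidal :=
  letI := Functor.OplaxMonoidal.ofChosenFiniteProducts (perfectionOver p S)
  haveI : IsIso (Functor.OplaxMonoidal.η (perfectionOver p S)) :=
    inferInstanceAs (IsIso (CartesianMonoidalCategory.terminalComparison (perfectionOver p S)))
  haveI : ∀ X Y, IsIso (Functor.OplaxMonoidal.δ (perfectionOver p S) X Y) := fun X Y =>
    inferInstanceAs (IsIso (CartesianMonoidalCategory.prodComparison (perfectionOver p S) X Y))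
  .ofOplaxMonoidal _

/-- The inverse perfection `G^pf` of a group scheme `G` over a perfect base `S`, as a group scheme
over `S`: its structure morphisms are the inverse perfections of those of `G`, by means of the
canonical isomorphism `(G × G)^pf ≅ G^pf × G^pf`. -/
def perfectionGrp (G : Grp (Over S)) : Grp (Over S) := (perfectionOver p S).mapGrp.obj G

end

end Over

end

end AlgebraicGeometry.InversePerfection

/-! ### Geometric points and the underlying space. -/

namespace AlgebraicGeometry

/-! A group scheme locally of finite type with only one geometric point may still be nontrivial, as
`μ_p` and `α_p` show, but it is nontrivial only through nilpotents, and inverse perfection cannot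
see these.

By the Nullstellensatz, every closed point of `G` is the image of a `kbar`-point, so `G` has at most
one closed point. As `G` is a Jacobson space, its closed points are dense, and `G` has at most one
point altogether (`subsingleton_of_subsingleton_geometricPoint`). The unit section `e` is then a
surjective closed immersion of `Spec k` into `G`.

A perfect scheme is reduced, so `G^pf ⟶ G` factors through `e`. Since `k` is perfect, `Spec k` is
perfect and `e` lifts to `G^pf`; the lift is inverse to the structure morphism of `G^pf`
(`isIso_perfectionOver_hom_of_section`). The group structure then needs no further work, because the
trivial group is carried by a terminal object. -/

/-- A closed point of a scheme locally of finite type over a field `k` is the image of a `k`-point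
with values in any algebraically closed extension of `k`. -/
theorem exists_geometricPoint_of_isClosed {k K : Type u} [Field k] [Field K] [Algebra k K]
    [IsAlgClosed K] {X : Scheme.{u}} (f : X ⟶ Spec (.of k)) [LocallyOfFiniteType f] {x : X}
    (hx : IsClosed {x}) :
    ∃ g : Spec (.of K) ⟶ X, g ≫ f = Spec.map (CommRingCat.ofHom (algebraMap k K)) ∧
      ∀ y, g y = x := by
  -- Zariski's lemma: the point being closed, its residue field is of finite type over `k`, hence
  -- finite.
  have hfin : IsFinite (X.fromSpecResidueField x ≫ f) := by
    rw [isClosed_singleton_iff_isClosedImmersion] at hx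
    rw [isFinite_iff_locallyOfFiniteType_of_jacobsonSpace]
    infer_instance
  let φ : CommRingCat.of k ⟶ X.residueField x := Spec.preimage (X.fromSpecResidueField x ≫ f)
  have hφ : Spec.map φ = X.fromSpecResidueField x ≫ f := Spec.map_preimage _
  have hint : φ.hom.IsIntegral := by
    rw [← IsIntegralHom.SpecMap_iff, hφ]
    infer_instance
  let : Algebra k (X.residueField x) := φ.hom.toAlgebra
  have : Algebra.IsIntegral k (X.residueField x) := ⟨hint⟩
  -- The residue field is algebraic over `k`, so it embeds into `K` over `k`, even when `K` is not
  -- algebraic over `k`.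
  let ψ : X.residueField x →ₐ[k] K := IsAlgClosed.lift
  refine ⟨Spec.map (CommRingCat.ofHom ψ.toRingHom) ≫ X.fromSpecResidueField x, ?_, fun y => ?_⟩
  · rw [Category.assoc, ← hφ, ← Spec.map_comp]
    congr 1
    ext a
    exact ψ.commutes a
  · rw [Scheme.Hom.comp_apply, Scheme.fromSpecResidueField_apply]

/-- A scheme locally of finite type over a field `k` with at most one geometric point has at most
one point. -/
theorem subsingleton_of_subsingleton_geometricPoint {k K : Type u} [Field k] [Field K]
    [Algebra k K] [IsAlgClosed K] {X : Scheme.{u}} (f : X ⟶ Spec (.of k)) [LocallyOfFiniteType f]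
    (h : ∀ g g' : Spec (.of K) ⟶ X, g ≫ f = Spec.map (CommRingCat.ofHom (algebraMap k K)) →
      g' ≫ f = Spec.map (CommRingCat.ofHom (algebraMap k K)) → g = g') :
    Subsingleton X := by
  have : JacobsonSpace X := LocallyOfFiniteType.jacobsonSpace f
  have hs : (closedPoints X).Subsingleton := by
    intro x hx y hy
    obtain ⟨g, hg, hgx⟩ := exists_geometricPoint_of_isClosed (K := K) f hx
    obtain ⟨g', hg', hgy⟩ := exists_geometricPoint_of_isClosed (K := K) f hy
    rw [← hgx (IsLocalRing.closedPoint K), ← hgy (IsLocalRing.closedPoint K), h g g' hg hg']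
  -- A set of closed points need not be closed in general; with at most one element it is. Being
  -- also dense in the Jacobson space `X`, it is all of `X`.
  have hc : IsClosed (closedPoints X) := by
    rcases hs.eq_empty_or_singleton with he | ⟨x, he⟩
    · rw [he]; exact isClosed_empty
    · have hx : x ∈ closedPoints X := he ▸ rfl
      rw [he]; exact hx
  rw [← Set.subsingleton_univ_iff, ← closure_closedPoints (X := X), hc.closure_eq]
  exact hs

/-! ### Reduced schemes and inverse perfection. -/

/-- A morphism from a reduced scheme factors through any surjective closed immersion. -/
theorem exists_fac_of_isReduced_of_isClosedImmersion_of_surjective {X Y Z : Scheme.{u}}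
    [IsReduced Z] (g : Z ⟶ Y) (i : X ⟶ Y) [IsClosedImmersion i] [Surjective i] :
    ∃ t : Z ⟶ X, t ≫ i = g := by
  -- The base change of `i` to `Z` is cut out by a nil ideal, which vanishes because `Z` is reduced.
  have : IsIso (pullback.fst g i) := isIso_of_isClosedImmersion_of_surjective _
  exact ⟨inv (pullback.fst g i) ≫ pullback.snd g i, by
    rw [Category.assoc, ← pullback.condition, IsIso.inv_hom_id_assoc]⟩

namespace InversePerfection

variable (p : ℕ) [Fact p.Prime]

/-- Frobenius is injective on sections, hence so are its iterates, and a high enough iterate kills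
any given nilpotent. -/
theorem IsPerfect.isReduced (X : Scheme.{u}) [IsFpScheme p X] [IsPerfect p X] : IsReduced X := by
  refine ⟨fun U => ⟨fun a ⟨n, hn⟩ => ?_⟩⟩
  refine pow_injective p (frob_bijective p X U).1 n ?_
  have hp := (Fact.out : p.Prime)
  change a ^ p ^ n = 0 ^ p ^ n
  rw [zero_pow (pow_ne_zero _ hp.ne_zero)]
  -- The nilpotency exponent `n` also serves as the number of iterations, since `n < p ^ n`.
  exact pow_eq_zero_of_le (Nat.lt_pow_self hp.one_lt).le hn

/-- If the `S`-scheme `X` has a section which is a surjective closed immersion, and `S` is perfect,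
then the inverse perfection of `X` is `S`. -/
theorem isIso_perfectionOver_hom_of_section {S : Scheme.{u}} [IsFpScheme p S] [IsPerfect p S]
    (X : Over S) (e : S ⟶ X.left) (he : e ≫ X.hom = 𝟙 S) [IsClosedImmersion e] [Surjective e] :
    IsIso ((perfectionOver p S).obj X).hom := by
  change IsIso (perfectionπ p X.left ≫ X.hom)
  have := IsPerfect.isReduced p (perfection p X.left)
  obtain ⟨t, ht⟩ := exists_fac_of_isReduced_of_isClosedImmersion_of_surjective
    (perfectionπ p X.left) e
  -- The inverse is the lift of `e`, available because `S` is perfect. One composite is checked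
  -- after projecting to `X`: writing the projection as `t ≫ e`, the endomorphism `X.hom ≫ e` of `X`
  -- fixes it, as `e ≫ X.hom = 𝟙 S`.
  refine ⟨perfectionLift p e, perfection_hom_ext p ?_, ?_⟩
  · rw [Category.assoc, perfectionLift_perfectionπ, Category.id_comp, ← ht, Category.assoc,
      Category.assoc, reassoc_of% he]
  · rw [perfectionLift_perfectionπ_assoc, he]

end InversePerfection

end AlgebraicGeometry

/-! ### Passage to group schemes. -/

open MonoidalCategory in
-- Compatibility with unit and multiplication is an equality of morphisms into a terminal object,
-- hence automatic.
theorem CategoryTheory.Grp.nonempty_iso_trivial_of_isIso {C : Type*} [Category C]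
    [CartesianMonoidalCategory C] (G : Grp C)
    (h : IsIso (CartesianMonoidalCategory.toUnit G.X)) : Nonempty (G ≅ Grp.trivial C) := by
  let e : G.X ≅ 𝟙_ C := asIso (CartesianMonoidalCategory.toUnit G.X)
  refine ⟨Grp.mkIso (H := Grp.trivial C) e ?_ ?_⟩ <;>
    exact CartesianMonoidalCategory.toUnit_unique _ _

theorem mainTheorem10 (p : ℕ) [Fact p.Prime] (k : Type u) [Field k] [CharP k p] [PerfectField k]
    (kbar : Type u) [Field kbar] [Algebra k kbar] [IsAlgClosure k kbar]
    (G : Grp (Over (Spec (.of k)))) [LocallyOfFiniteType G.X.hom]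
    (hG : Subsingleton (Over.mk (Spec.map (CommRingCat.ofHom (algebraMap k kbar))) ⟶ G.X)) :
    Nonempty (AlgebraicGeometry.InversePerfection.perfectionGrp p G ≅
      Grp.trivial (Over (Spec (.of k)))) := by
  have : IsAlgClosed kbar := IsAlgClosure.isAlgClosed k
  have : Subsingleton G.X.left :=
    subsingleton_of_subsingleton_geometricPoint (K := kbar) G.X.hom fun g g' hg hg' =>
      congrArg CommaMorphism.left (hG.elim (Over.homMk g hg) (Over.homMk g' hg'))
  let e : Spec (.of k) ⟶ G.X.left := (MonObj.one (X := G.X)).left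
  have he : e ≫ G.X.hom = 𝟙 (Spec (.of k)) := Over.w (MonObj.one (X := G.X))
  -- A rational point of a `k`-scheme is closed, with residue field `k`.
  have : IsClosedImmersion e := isClosedImmersion_of_comp_eq_id _ _ he
  have : Surjective e := ⟨fun x => ⟨IsLocalRing.closedPoint k, Subsingleton.elim _ _⟩⟩
  have hiso := InversePerfection.isIso_perfectionOver_hom_of_section p G.X e he
  refine Grp.nonempty_iso_trivial_of_isIso _ ?_
  -- The morphism of schemes underlying `toUnit` is the structure morphism of `G^pf`, and forgetting
  -- the base reflects isomorphisms.
  have : IsIso ((Over.forget _).map (CartesianMonoidalCategory.toUnit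
      (InversePerfection.perfectionGrp p G).X)) := hiso
  exact isIso_of_reflects_iso _ (Over.forget _)
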